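/- An ultragraph $\mathcal G=(G^0,\mathcal G^1,r,s)$ consists of countable sets $G^0$ (vertices) and $\mathcal G^1$ (edges), a map $s:\mathcal G^1\to G^0$, and a map $r$ assigning to each edge a non-empty subset of $G^0$. Let $\mathcal G^0$ be the smallest collection of subsets of $G^0$ that contains $\emptyset$, $\{v\}$ for all $v\in G^0$ and $r(e)$ for all $e\in\mathcal G^1$, and is closed under pairwise unions and intersections. The ultragraph algebra $C^*(\mathcal G)$ is the universal $C^*$-algebra generated by a Cuntz–Krieger $\mathcal G$-family, i.e. by partial isometries $\{s_e:e\in\mathcal G^1\}$ with mutually orthogonal ranges and projections $\{p_A:A\in\mathcal G^0\}$ such that 1. $p_\emptyset=0$, $p_Ap_B=p_{A\cap B}$ and $p_{A\cup B}=p_A+p_B-p_{A\cap B}$ for all $A,B\in\mathcal G^0$; 2. $s_e^*s_e=p_{r(e)}$ and $s_es_e^*\le p_{\{s(e)\}}$ for all $e\in\mathcal G^1$; 3. $p_{\{v\}}=\sum_{s(e)=v}s_es_e^*$ whenever $0<|s^{-1}(v)|<\infty$. For a directed graph $E=(E^0,E^1,r,s)$ (parallel edges and loops allowed), the graph algebra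 $C^*(E)$ is the universal $C^*$-algebra generated by a Cuntz–Krieger $E$-family, i.e. by mutually orthogonal projections $\{p_v:v\in E^0\}$ and partial isometries $\{s_e:e\in E^1\}$ with mutually orthogonal ranges such that $s_e^*s_e=p_{r(e)}$ and $s_es_e^*\le p_{s(e)}$ for all $e\in E^1$, and $p_v=\sum_{s(e)=v}s_es_e^*$ whenever $0<|s^{-1}(v)|<\infty$. The underlying directed graph $E_{\mathcal G}$ of $\mathcal G$ has vertex set $G^0$ and edge set $\{(e,w):e\in\mathcal G^1,\ w\in r(e)\}$, where $(e,w)$ has source $s(e)$ and range $w$. The ultragraph $\mathcal G$ is row-finite if $s^{-1}(v)$ is finite for every $v\in G^0$ and $r(e)$ is finite for every $e\in\mathcal G^1$. **Corollary 6.7.** If $\mathcal G$ is a row-finite ultragraph, then $C^*(\mathcal G)$ and $C^*(E_{\mathcal G})$ are isomorphic as $C^*$-algebras (i.e. $*$-isomorphic). -/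

import Mathlib

open scoped ENNReal

universe u v w

/-! ### Directed graphs and ultragraphs -/

/-- A directed graph with vertex set `V` and edge set `E`; loops and parallel edges are allowed. -/
structure DirectedGraph (V : Type u) (E : Type v) where
  /-- the source of an edge -/
  s : E → V
  /-- the range of an edge -/
  r : E → V

/-- An ultragraph with vertex set `V` and edge set `E`: the source of an edge is a vertex, its range
is a non-empty set of vertices. -/
structure Ultragraph (V : Type u) (E : Type v) where
  /-- the source of an edge -/
  s : E → V
  /-- the range of an edge -/
  r : E → Set V
  range_nonempty : ∀ e, (r e).Nonempty

namespace Ultragraph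

variable {V : Type u} {E : Type v}

/-- Membership in the smallest collection of subsets of `V` which contains the singletons of all
vertices and the ranges of all edges and is closed under finite unions (the empty one included) and
finite (non-empty) intersections. -/
inductive IsGeneralizedVertex (G : Ultragraph V E) : Set V → Prop
  | empty : IsGeneralizedVertex G ∅
  | singleton (a : V) : IsGeneralizedVertex G {a}
  | range (e : E) : IsGeneralizedVertex G (G.r e)
  | inter {A B : Set V} : IsGeneralizedVertex G A → IsGeneralizedVertex G B →
      IsGeneralizedVertex G (A ∩ B)
  | union {A B : Set V} : IsGeneralizedVertex G A → IsGeneralizedVertex G B →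
      IsGeneralizedVertex G (A ∪ B)

/-- The collection `𝒢⁰`. -/
abbrev GeneralizedVertex (G : Ultragraph V E) : Type u := {A : Set V // G.IsGeneralizedVertex A}

/-- No vertex emits infinitely many edges, and every edge has a finite range. -/
structure RowFinite (G : Ultragraph V E) : Prop where
  finite_emission : ∀ a : V, (G.s ⁻¹' {a}).Finite
  finite_range : ∀ e : E, (G.r e).Finite

/-- The underlying directed graph `E_𝒢` of an ultragraph: each edge `e` contributes one edge from
`s(e)` to `b` for every `b ∈ r(e)`. -/
def underlyingGraph (G : Ultragraph V E) : DirectedGraph V {x : E × V // x.2 ∈ G.r x.1} where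
  s x := G.s x.1.1
  r x := x.1.2

end Ultragraph

/-! ### Cuntz-Krieger families -/

section Families

variable {V : Type u} {E : Type v}

/-- A partial isometry of a C*-algebra. -/
def IsPartialIsometry {B : Type w} [NonUnitalCStarAlgebra B] (a : B) : Prop :=
  a * star a * a = a

/-- A Cuntz-Krieger `𝒢`-family of an ultragraph `𝒢` in a C*-algebra. For projections, `q ≤ p` is
written as `p * q = q`. -/
structure Ultragraph.IsCuntzKriegerFamily (G : Ultragraph V E) {B : Type w}
    [NonUnitalCStarAlgebra B] (S : E → B) (P : G.GeneralizedVertex → B) : Prop where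
  partialIsometry : ∀ e, IsPartialIsometry (S e)
  orthogonal_ranges : ∀ e f, e ≠ f → (S e * star (S e)) * (S f * star (S f)) = 0
  projection : ∀ A, IsStarProjection (P A)
  map_empty : P ⟨∅, .empty⟩ = 0
  map_inter : ∀ A A' : G.GeneralizedVertex, P A * P A' = P ⟨A.1 ∩ A'.1, .inter A.2 A'.2⟩
  map_union : ∀ A A' : G.GeneralizedVertex,
    P ⟨A.1 ∪ A'.1, .union A.2 A'.2⟩ = P A + P A' - P ⟨A.1 ∩ A'.1, .inter A.2 A'.2⟩
  star_mul_self : ∀ e, star (S e) * S e = P ⟨G.r e, .range e⟩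
  range_le : ∀ e, P ⟨{G.s e}, .singleton _⟩ * (S e * star (S e)) = S e * star (S e)
  sum_ranges : ∀ (a : V) (h : (G.s ⁻¹' {a}).Finite), (G.s ⁻¹' {a}).Nonempty →
    P ⟨{a}, .singleton a⟩ = ∑ e ∈ h.toFinset, S e * star (S e)

/-- A Cuntz-Krieger `E`-family of a directed graph in a C*-algebra. For projections, `q ≤ p` is
written as `p * q = q`. -/
structure DirectedGraph.IsCuntzKriegerFamily (Γ : DirectedGraph V E) {B : Type w}
    [NonUnitalCStarAlgebra B] (S : E → B) (P : V → B) : Prop where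
  partialIsometry : ∀ e, IsPartialIsometry (S e)
  orthogonal_ranges : ∀ e f, e ≠ f → (S e * star (S e)) * (S f * star (S f)) = 0
  projection : ∀ a, IsStarProjection (P a)
  orthogonal : ∀ a b, a ≠ b → P a * P b = 0
  star_mul_self : ∀ e, star (S e) * S e = P (Γ.r e)
  range_le : ∀ e, P (Γ.s e) * (S e * star (S e)) = S e * star (S e)
  sum_ranges : ∀ (a : V) (h : (Γ.s ⁻¹' {a}).Finite), (Γ.s ⁻¹' {a}).Nonempty →
    P a = ∑ e ∈ h.toFinset, S e * star (S e)

end Families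

/-! ### The universal C*-algebra of a system of relations -/

/-- Relations on families of elements of C*-algebras, indexed by `X`, which bound the norm of each
member of the family. -/
structure CStarRelations (X : Type u) where
  /-- the relations hold for the family `f` -/
  Holds : ∀ (B : Type w) [NonUnitalCStarAlgebra B], (X → B) → Prop
  bounded : ∀ x, ∃ C : ℝ, ∀ (B : Type w) [NonUnitalCStarAlgebra B] (f : X → B),
    Holds B f → ‖f x‖ ≤ C

namespace CStarRelations

variable {X : Type u}

/-- A C*-algebra together with a family that satisfies the relations. -/
structure Representation (R : CStarRelations.{u, w} X) where
  /-- the C*-algebra -/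
  carrier : Type w
  [cstar : NonUnitalCStarAlgebra carrier]
  /-- the family -/
  family : X → carrier
  holds : R.Holds carrier family

attribute [instance] Representation.cstar

/-- The direct sum of all representations: the family in the `ℓ^∞`-product of the C*-algebras of all
representations whose coordinates are the given families. -/
noncomputable def productFamily (R : CStarRelations.{u, w} X) (x : X) :
    lp (fun ρ : R.Representation => ρ.carrier) ∞ :=
  ⟨fun ρ => ρ.family x, memℓp_infty (by
    obtain ⟨C, hC⟩ := R.bounded x
    exact ⟨C, by rintro _ ⟨ρ, rfl⟩; exact hC _ _ ρ.holds⟩)⟩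

/-- The C*-subalgebra generated by the direct sum of all representations. -/
noncomputable def generatedSubalgebra (R : CStarRelations.{u, w} X) :
    NonUnitalStarSubalgebra ℂ (lp (fun ρ : R.Representation => ρ.carrier) ∞) :=
  (NonUnitalStarAlgebra.adjoin ℂ (Set.range R.productFamily)).topologicalClosure

/-- The universal C*-algebra generated by a family that satisfies the relations. -/
def UniversalAlgebra (R : CStarRelations.{u, w} X) : Type (max u (w + 1)) :=
  R.generatedSubalgebra

noncomputable instance (R : CStarRelations.{u, w} X) : NonUnitalCStarAlgebra R.UniversalAlgebra :=
  NonUnitalStarSubalgebra.nonUnitalCStarAlgebra R.generatedSubalgebra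
    (h_closed := NonUnitalStarSubalgebra.isClosed_topologicalClosure _)

/-- The canonical generators of the universal C*-algebra. -/
noncomputable def generator (R : CStarRelations.{u, w} X) (x : X) : R.UniversalAlgebra :=
  (⟨R.productFamily x, NonUnitalStarSubalgebra.le_topologicalClosure _
    (NonUnitalStarAlgebra.subset_adjoin ℂ _ ⟨x, rfl⟩)⟩ : R.generatedSubalgebra)

end CStarRelations

/-! ### Ultragraph algebras and graph algebras -/

section Algebras

variable {V : Type u} {E : Type v}

theorem norm_le_one_of_star_mul_self {B : Type w} [NonUnitalCStarAlgebra B] {a p : B}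
    (hp : IsStarProjection p) (h : star a * a = p) : ‖a‖ ≤ 1 := by
  have h1 : ‖a‖ * ‖a‖ = ‖p‖ := by rw [← h, CStarRing.norm_star_mul_self]
  have h2 := hp.norm_le
  nlinarith [norm_nonneg a]

/-- The relations of a Cuntz-Krieger `𝒢`-family. -/
def Ultragraph.cuntzKriegerRelations (G : Ultragraph V E) :
    CStarRelations.{max u v, w} (E ⊕ G.GeneralizedVertex) where
  Holds _ _ f := G.IsCuntzKriegerFamily (fun e => f (.inl e)) (fun A => f (.inr A))
  bounded x := ⟨1, fun B _ f hf => by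
    rcases x with e | A
    · exact norm_le_one_of_star_mul_self (hf.projection _) (hf.star_mul_self e)
    · exact (hf.projection A).norm_le⟩

/-- The ultragraph algebra `C*(𝒢)`: the universal C*-algebra for Cuntz-Krieger `𝒢`-families. -/
abbrev Ultragraph.CStar (G : Ultragraph V E) : Type (max u v (w + 1)) :=
  CStarRelations.UniversalAlgebra.{max u v, w} G.cuntzKriegerRelations

/-- The relations of a Cuntz-Krieger `E`-family. -/
def DirectedGraph.cuntzKriegerRelations (Γ : DirectedGraph V E) :
    CStarRelations.{max u v, w} (E ⊕ V) where
  Holds _ _ f := Γ.IsCuntzKriegerFamily (fun e => f (.inl e)) (fun a => f (.inr a))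
  bounded x := ⟨1, fun B _ f hf => by
    rcases x with e | a
    · exact norm_le_one_of_star_mul_self (hf.projection _) (hf.star_mul_self e)
    · exact (hf.projection a).norm_le⟩

/-- The graph algebra `C*(E)`: the universal C*-algebra for Cuntz-Krieger `E`-families. -/
abbrev DirectedGraph.CStar (Γ : DirectedGraph V E) : Type (max u v (w + 1)) :=
  CStarRelations.UniversalAlgebra.{max u v, w} Γ.cuntzKriegerRelations

end Algebras

/-! Row-finiteness makes every set in `𝒢⁰` finite, so `p_A` is the finite sum of the `p_{w}`, `w ∈
A`, and the two kinds of families determine each other inside any C*-algebra. Splitting sets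
`t_(e,w) = s_e p_{w}` and `q_w = p_{w}`; merging sets `s_e = ∑_{w ∈ r(e)} t_(e,w)` and `p_A = ∑_{w ∈
A} q_w`. Both recipes preserve the Cuntz-Krieger relations (`split`, `merge_isCuntzKriegerFamily`)
and are mutually inverse. Each universal algebra is a closed subalgebra of the product over all
representations, so a recipe acts by reindexing coordinates. As both recipes are polynomial in the
generators, the reindexings restrict to inverse *-homomorphisms of the universal algebras
(`universalAlgebraEquiv`). -/

/-! ### Transformations of relations and the induced maps of universal algebras. -/

namespace CStarRelations

variable {X : Type u} {Y : Type v} {R : CStarRelations.{u, w} X} {R' : CStarRelations.{v, w} Y}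

/-- A recipe turning every family that satisfies `R` into a family, in the same C*-algebra, that
satisfies `R'`. -/
structure Transformation (R : CStarRelations.{u, w} X) (R' : CStarRelations.{v, w} Y) where
  /-- the transformed family -/
  toFun : ∀ (B : Type w) [NonUnitalCStarAlgebra B], (X → B) → Y → B
  holds : ∀ (B : Type w) [NonUnitalCStarAlgebra B] (f : X → B),
    R.Holds B f → R'.Holds B (toFun B f)

namespace Transformation

/-- The representation of `R'` obtained from a representation of `R`. -/
def mapRepresentation (F : Transformation R R') (ρ : R.Representation) : R'.Representation where
  carrier := ρ.carrier
  family := F.toFun ρ.carrier ρ.family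
  holds := F.holds _ _ ρ.holds

/-- Reindexing of the products of all representations along a transformation. -/
noncomputable def productHom (F : Transformation R R') :
    lp (fun ρ : R'.Representation => ρ.carrier) ∞ →⋆ₙₐ[ℂ]
      lp (fun ρ : R.Representation => ρ.carrier) ∞ where
  toFun x := ⟨fun ρ => x (F.mapRepresentation ρ), memℓp_infty (by
    obtain ⟨C, hC⟩ := memℓp_infty_iff.1 (lp.memℓp x)
    exact ⟨C, by rintro _ ⟨ρ, rfl⟩; exact hC ⟨_, rfl⟩⟩)⟩
  map_smul' _ _ := rfl
  map_zero' := rfl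
  map_add' _ _ := rfl
  map_mul' _ _ := rfl
  map_star' _ := rfl

theorem continuous_productHom (F : Transformation R R') : Continuous F.productHom := by
  open scoped CStarAlgebra in
  -- *-homomorphisms between C*-algebras are automatically continuous.
  exact map_continuous F.productHom

/-- The members of the transformed family are polynomials in the members of the original one. -/
def IsPolynomial (F : Transformation R R') : Prop :=
  ∀ y, ∃ z ∈ NonUnitalStarAlgebra.adjoin ℂ (Set.range R.productFamily),
    ∀ ρ : R.Representation, z ρ = F.toFun ρ.carrier ρ.family y

/-- Generators map to polynomials in the generators, and the preimage of a closed *-subalgebra under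
a continuous *-homomorphism is again one. -/
theorem productHom_mem {F : Transformation R R'} (hF : F.IsPolynomial)
    {x : lp (fun ρ : R'.Representation => ρ.carrier) ∞} (hx : x ∈ R'.generatedSubalgebra) :
    F.productHom x ∈ R.generatedSubalgebra := by
  have h : NonUnitalStarAlgebra.adjoin ℂ (Set.range R'.productFamily) ≤
      R.generatedSubalgebra.comap F.productHom := by
    refine NonUnitalStarAlgebra.adjoin_le ?_
    rintro _ ⟨y, rfl⟩
    obtain ⟨z, hz, hzy⟩ := hF y
    have : F.productHom (R'.productFamily y) = z :=
      lp.ext (funext fun ρ => (hzy ρ).symm)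
    change F.productHom (R'.productFamily y) ∈ R.generatedSubalgebra
    rw [this]
    exact NonUnitalStarSubalgebra.le_topologicalClosure _ hz
  refine NonUnitalStarSubalgebra.topologicalClosure_minimal _ h ?_ hx
  exact (NonUnitalStarSubalgebra.isClosed_topologicalClosure _).preimage F.continuous_productHom

/-- Two continuous *-homomorphisms that agree on generators agree on the closure. On generators only
families are compared, so no equality of representations is needed. -/
theorem productHom_productHom {F : Transformation R R'} {F' : Transformation R' R}
    (h : ∀ (B : Type w) [NonUnitalCStarAlgebra B] (f : Y → B),
      R'.Holds B f → F.toFun B (F'.toFun B f) = f)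
    {x : lp (fun ρ : R'.Representation => ρ.carrier) ∞} (hx : x ∈ R'.generatedSubalgebra) :
    F'.productHom (F.productHom x) = x := by
  have hle : NonUnitalStarAlgebra.adjoin ℂ (Set.range R'.productFamily) ≤
      NonUnitalStarAlgHom.equalizer (F'.productHom.comp F.productHom)
        (NonUnitalStarAlgHom.id ℂ _) := by
    refine NonUnitalStarAlgebra.adjoin_le ?_
    rintro _ ⟨y, rfl⟩
    exact lp.ext (funext fun ρ => congrFun (h ρ.carrier ρ.family ρ.holds) y)
  exact NonUnitalStarSubalgebra.topologicalClosure_minimal _ hle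
    (isClosed_eq (F'.continuous_productHom.comp F.continuous_productHom) continuous_id) hx

end Transformation

/-- Mutually inverse polynomial transformations induce an isomorphism of universal C*-algebras. -/
noncomputable def universalAlgebraEquiv (F : Transformation R R') (F' : Transformation R' R)
    (hF : F.IsPolynomial) (hF' : F'.IsPolynomial)
    (h : ∀ (B : Type w) [NonUnitalCStarAlgebra B] (f : X → B),
      R.Holds B f → F'.toFun B (F.toFun B f) = f)
    (h' : ∀ (B : Type w) [NonUnitalCStarAlgebra B] (f : Y → B),
      R'.Holds B f → F.toFun B (F'.toFun B f) = f) :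
    R.UniversalAlgebra ≃⋆ₐ[ℂ] R'.UniversalAlgebra where
  toFun x := ⟨F'.productHom x.1, Transformation.productHom_mem hF' x.2⟩
  invFun x := ⟨F.productHom x.1, Transformation.productHom_mem hF x.2⟩
  left_inv x := Subtype.ext (Transformation.productHom_productHom h x.2)
  right_inv x := Subtype.ext (Transformation.productHom_productHom h' x.2)
  map_mul' _ _ := rfl
  map_add' _ _ := rfl
  map_star' _ := rfl
  map_smul' _ _ := rfl

end CStarRelations

/-! ### Orthogonality in graph families. -/

theorem IsPartialIsometry.star_mul_eq_zero {B : Type w} [NonUnitalCStarAlgebra B] {a b : B}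
    (ha : IsPartialIsometry a) (hb : IsPartialIsometry b)
    (h : (a * star a) * (b * star b) = 0) : star a * b = 0 := by
  have ha' : star a * (a * star a) = star a := by
    simpa [mul_assoc] using congrArg star ha
  calc star a * b = star a * (a * star a) * (b * star b * b) := by rw [ha', hb]
    _ = star a * ((a * star a) * (b * star b)) * b := by simp only [mul_assoc]
    _ = 0 := by rw [h, mul_zero, zero_mul]

namespace DirectedGraph.IsCuntzKriegerFamily

variable {V : Type u} {E : Type v} {Γ : DirectedGraph V E} {B : Type w} [NonUnitalCStarAlgebra B]
  {T : E → B} {Q : V → B}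

theorem star_mul_eq_zero (h : Γ.IsCuntzKriegerFamily T Q) {e f : E} (hef : e ≠ f) :
    star (T e) * T f = 0 :=
  (h.partialIsometry e).star_mul_eq_zero (h.partialIsometry f) (h.orthogonal_ranges e f hef)

theorem source_mul (h : Γ.IsCuntzKriegerFamily T Q) (e : E) : Q (Γ.s e) * T e = T e := by
  rw [← h.partialIsometry e, ← mul_assoc, h.range_le]

theorem mul_range (h : Γ.IsCuntzKriegerFamily T Q) (e : E) : T e * Q (Γ.r e) = T e := by
  rw [← h.star_mul_self, ← mul_assoc]
  exact h.partialIsometry e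

theorem mul_eq_zero (h : Γ.IsCuntzKriegerFamily T Q) {e : E} {a : V} (ha : Γ.r e ≠ a) :
    T e * Q a = 0 := by
  rw [← h.mul_range, mul_assoc, h.orthogonal _ _ ha, mul_zero]

theorem mul_star_eq_zero (h : Γ.IsCuntzKriegerFamily T Q) {e f : E} (hef : Γ.r e ≠ Γ.r f) :
    T e * star (T f) = 0 := by
  rw [← h.mul_range f, star_mul, (h.projection _).isSelfAdjoint.star_eq, ← mul_assoc,
    h.mul_eq_zero hef, zero_mul]

/-- By orthogonality only the diagonal terms survive. This yields `p_A p_B = p_{A ∩ B}` for merged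
families. -/
theorem sum_mul_sum [DecidableEq V] (h : Γ.IsCuntzKriegerFamily T Q) (s t : Finset V) :
    (∑ a ∈ s, Q a) * ∑ a ∈ t, Q a = ∑ a ∈ s ∩ t, Q a := by
  rw [Finset.sum_mul_sum, ← Finset.sum_ite_mem]
  refine Finset.sum_congr rfl fun a _ => ?_
  rw [← Finset.sum_ite_eq t a Q]
  refine Finset.sum_congr rfl fun b _ => ?_
  split_ifs with hab
  · rw [← hab, (h.projection a).isIdempotentElem]
  · exact h.orthogonal a b hab

end DirectedGraph.IsCuntzKriegerFamily

/-! ### Generalized vertices of a row-finite ultragraph, and the two recipes. -/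

namespace Ultragraph

variable {V : Type u} {E : Type v} {G : Ultragraph V E} {B : Type w} [NonUnitalCStarAlgebra B]

theorem RowFinite.finite_generalizedVertex (hG : G.RowFinite) (A : G.GeneralizedVertex) :
    A.1.Finite := by
  obtain ⟨A, hA⟩ := A
  induction hA with
  | empty => exact Set.finite_empty
  | singleton a => exact Set.finite_singleton a
  | range e => exact hG.finite_range e
  | inter _ _ h _ => exact h.inter_of_left _
  | union _ _ h h' => exact h.union h'

/-- Together with `RowFinite.finite_generalizedVertex`, this identifies `𝒢⁰` with the finite subsets
of `V`. -/
theorem IsGeneralizedVertex.finset (s : Finset V) : G.IsGeneralizedVertex (s : Set V) := by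
  classical
  induction s using Finset.induction_on with
  | empty => simpa using IsGeneralizedVertex.empty
  | insert a s _ ih =>
    rw [Finset.coe_insert, Set.insert_eq]
    exact .union (.singleton a) ih

/-- The edges of the underlying graph that start at `a`, grouped by the edges of the ultragraph. -/
theorem sum_underlyingGraph_source [∀ e, Fintype (G.r e)] {M : Type w} [AddCommMonoid M] {a : V}
    (h : (G.underlyingGraph.s ⁻¹' {a}).Finite) (h' : (G.s ⁻¹' {a}).Finite)
    (g : {x : E × V // x.2 ∈ G.r x.1} → M) :
    ∑ x ∈ h.toFinset, g x = ∑ e ∈ h'.toFinset, ∑ b : G.r e, g ⟨(e, b), b.2⟩ := by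
  rw [Finset.sum_sigma']
  refine Finset.sum_bij' (fun x _ => ⟨x.1.1, ⟨x.1.2, x.2⟩⟩) (fun y _ => ⟨(y.1, y.2), y.2.2⟩)
    ?_ ?_ ?_ ?_ ?_
  all_goals simp [underlyingGraph]

/-- The edges of a Cuntz-Krieger family of the underlying graph. -/
def splitEdge (S : E → B) (P : G.GeneralizedVertex → B) (x : {x : E × V // x.2 ∈ G.r x.1}) : B :=
  S x.1.1 * P ⟨{x.1.2}, .singleton _⟩

/-- The edges of a Cuntz-Krieger family of the ultragraph. -/
def mergeEdge [∀ e, Fintype (G.r e)] (T : {x : E × V // x.2 ∈ G.r x.1} → B) (e : E) : B :=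
  ∑ b : G.r e, T ⟨(e, b), b.2⟩

/-- The projections of a Cuntz-Krieger family of the ultragraph. -/
noncomputable def mergeVertex (hG : G.RowFinite) (Q : V → B) (A : G.GeneralizedVertex) : B :=
  ∑ a ∈ (hG.finite_generalizedVertex A).toFinset, Q a

/-! ### From ultragraph families to graph families. -/

section Split

variable {S : E → B} {P : G.GeneralizedVertex → B}

namespace IsCuntzKriegerFamily

theorem star_mul_eq_zero (h : G.IsCuntzKriegerFamily S P) {e f : E} (hef : e ≠ f) :
    star (S e) * S f = 0 :=
  (h.partialIsometry e).star_mul_eq_zero (h.partialIsometry f) (h.orthogonal_ranges e f hef)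

theorem mul_range (h : G.IsCuntzKriegerFamily S P) (e : E) : S e * P ⟨G.r e, .range e⟩ = S e := by
  rw [← h.star_mul_self, ← mul_assoc]
  exact h.partialIsometry e

theorem source_mul (h : G.IsCuntzKriegerFamily S P) (e : E) :
    P ⟨{G.s e}, .singleton _⟩ * S e = S e := by
  rw [← h.partialIsometry e, ← mul_assoc, h.range_le]

theorem orthogonal (h : G.IsCuntzKriegerFamily S P) {a b : V} (hab : a ≠ b) :
    P ⟨{a}, .singleton a⟩ * P ⟨{b}, .singleton b⟩ = 0 := by
  rw [h.map_inter, ← h.map_empty]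
  congr 2
  simpa using hab.symm

/-- The union relation is additive on disjoint sets because `p_∅ = 0`; hence the singletons
determine `p` on all finite sets. -/
theorem map_finset (h : G.IsCuntzKriegerFamily S P) (s : Finset V) :
    P ⟨s, .finset s⟩ = ∑ a ∈ s, P ⟨{a}, .singleton a⟩ := by
  classical
  induction s using Finset.induction_on with
  | empty =>
    rw [Finset.sum_empty, ← h.map_empty]
    congr 2
    simp
  | insert a s ha ih =>
    rw [Finset.sum_insert ha, ← ih]
    have h1 := h.map_union ⟨{a}, .singleton a⟩ ⟨s, .finset s⟩
    have h2 : P ⟨{a} ∩ (s : Set V), .inter (.singleton a) (.finset s)⟩ = 0 := by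
      rw [← h.map_empty]
      congr 2
      simpa using ha
    rw [h2, sub_zero] at h1
    rw [← h1]
    congr 2
    exact Finset.coe_insert a s

theorem mergeVertex_eq (h : G.IsCuntzKriegerFamily S P) (hG : G.RowFinite)
    (A : G.GeneralizedVertex) : mergeVertex hG (fun a => P ⟨{a}, .singleton a⟩) A = P A := by
  rw [mergeVertex, ← h.map_finset]
  congr 2
  simp

theorem map_range [∀ e, Fintype (G.r e)] (h : G.IsCuntzKriegerFamily S P) (e : E) :
    P ⟨G.r e, .range e⟩ = ∑ b : G.r e, P ⟨{b.1}, .singleton b.1⟩ := by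
  rw [Finset.sum_set_coe (G.r e) (f := fun b => P ⟨{b}, .singleton b⟩), ← h.map_finset]
  congr 2
  simp

/-- `∑_w s_e p_{w} = s_e p_{r(e)} = s_e`. -/
theorem mergeEdge_splitEdge [∀ e, Fintype (G.r e)] (h : G.IsCuntzKriegerFamily S P) (e : E) :
    mergeEdge (splitEdge S P) e = S e := by
  simp only [mergeEdge, splitEdge]
  rw [← Finset.mul_sum, ← h.map_range, h.mul_range]

theorem star_splitEdge_mul (h : G.IsCuntzKriegerFamily S P)
    (x : {x : E × V // x.2 ∈ G.r x.1}) :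
    star (splitEdge S P x) * splitEdge S P x = P ⟨{x.1.2}, .singleton _⟩ := by
  rw [splitEdge, star_mul, (h.projection _).isSelfAdjoint.star_eq, mul_assoc,
    ← mul_assoc (star (S _)), h.star_mul_self, h.map_inter, h.map_inter]
  congr 2
  simpa using x.2

theorem splitEdge_mul_star (h : G.IsCuntzKriegerFamily S P)
    (x : {x : E × V // x.2 ∈ G.r x.1}) :
    splitEdge S P x * star (splitEdge S P x) =
      S x.1.1 * P ⟨{x.1.2}, .singleton _⟩ * star (S x.1.1) := by
  rw [splitEdge, star_mul, (h.projection _).isSelfAdjoint.star_eq, mul_assoc,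
    ← mul_assoc (P _) (P _), (h.projection _).isIdempotentElem, ← mul_assoc]

theorem split (hG : G.RowFinite) (h : G.IsCuntzKriegerFamily S P) :
    G.underlyingGraph.IsCuntzKriegerFamily (splitEdge S P) (fun a => P ⟨{a}, .singleton a⟩) where
  partialIsometry x := by
    rw [IsPartialIsometry, mul_assoc, h.star_splitEdge_mul, splitEdge, mul_assoc,
      (h.projection _).isIdempotentElem]
  orthogonal_ranges x y hxy := by
    have key : star (splitEdge S P x) * splitEdge S P y = 0 := by
      rw [splitEdge, splitEdge, star_mul, (h.projection _).isSelfAdjoint.star_eq, mul_assoc,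
        ← mul_assoc (star _)]
      -- For equal ultragraph edges the middle factor is `p_{r(e)}`, and the two distinct endpoint
      -- projections annihilate each other; otherwise `s_e^* s_f = 0`.
      by_cases he : x.1.1 = y.1.1
      · have hw : x.1.2 ≠ y.1.2 := fun hw => hxy (Subtype.ext (Prod.ext he hw))
        rw [he, h.star_mul_self, h.map_inter, h.map_inter, ← h.map_empty]
        congr 2
        ext b
        simp only [Set.mem_inter_iff, Set.mem_singleton_iff, Set.mem_empty_iff_false, iff_false]
        rintro ⟨rfl, -, h2⟩
        exact hw h2
      · rw [h.star_mul_eq_zero he, zero_mul, mul_zero]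
    rw [mul_assoc, ← mul_assoc (star _), key, zero_mul, mul_zero]
  projection a := h.projection _
  orthogonal a b hab := h.orthogonal hab
  star_mul_self x := h.star_splitEdge_mul x
  range_le x := by
    rw [← mul_assoc]
    congr 1
    rw [splitEdge, ← mul_assoc]
    congr 1
    exact h.source_mul _
  sum_ranges a hfin hne := by
    let := fun e => (hG.finite_range e).fintype
    obtain ⟨x, hx⟩ := hne
    rw [sum_underlyingGraph_source hfin (hG.finite_emission a),
      h.sum_ranges a (hG.finite_emission a) ⟨x.1.1, hx⟩]
    refine Finset.sum_congr rfl fun e _ => ?_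
    simp only [h.splitEdge_mul_star]
    -- The inner sum collapses: `∑_w s_e p_{w} s_e^* = s_e p_{r(e)} s_e^* = s_e s_e^*`.
    rw [← Finset.sum_mul, ← Finset.mul_sum, ← h.map_range, h.mul_range]

end IsCuntzKriegerFamily

end Split

/-! ### From graph families to ultragraph families. -/

section Merge

variable {T : {x : E × V // x.2 ∈ G.r x.1} → B} {Q : V → B}

theorem mergeVertex_singleton (hG : G.RowFinite) (a : V) :
    mergeVertex hG Q ⟨{a}, .singleton a⟩ = Q a := by
  simp [mergeVertex]

theorem mergeVertex_mul (hG : G.RowFinite) (h : G.underlyingGraph.IsCuntzKriegerFamily T Q)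
    (A A' : G.GeneralizedVertex) : mergeVertex hG Q A * mergeVertex hG Q A' =
      mergeVertex hG Q ⟨A.1 ∩ A'.1, .inter A.2 A'.2⟩ := by
  classical
  rw [mergeVertex, mergeVertex, mergeVertex, h.sum_mul_sum]
  congr 1
  ext
  simp

variable [∀ e, Fintype (G.r e)]

theorem mergeVertex_range (hG : G.RowFinite) (e : E) :
    mergeVertex hG Q ⟨G.r e, .range e⟩ = ∑ b : G.r e, Q b := by
  rw [Finset.sum_set_coe (G.r e), mergeVertex]
  congr 1
  ext
  simp

/-- Right multiplication by `q_w` keeps `t_(e,w)` and kills the other summands of `s_e`. -/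
theorem splitEdge_merge (hG : G.RowFinite) (h : G.underlyingGraph.IsCuntzKriegerFamily T Q)
    (x : {x : E × V // x.2 ∈ G.r x.1}) :
    splitEdge (mergeEdge T) (mergeVertex hG Q) x = T x := by
  rw [splitEdge, mergeVertex_singleton, mergeEdge, Finset.sum_mul,
    Finset.sum_eq_single ⟨x.1.2, x.2⟩]
  · exact h.mul_range x
  · intro b _ hb
    exact h.mul_eq_zero fun hb' => hb (Subtype.ext hb')
  · simp

/-- Cross terms vanish because distinct `t_(e,b)`, `t_(e,c)` have orthogonal initial projections
`q_b`, `q_c`. -/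
theorem mergeEdge_mul_star (h : G.underlyingGraph.IsCuntzKriegerFamily T Q) (e : E) :
    mergeEdge T e * star (mergeEdge T e) =
      ∑ b : G.r e, T ⟨(e, b), b.2⟩ * star (T ⟨(e, b), b.2⟩) := by
  rw [mergeEdge, star_sum, Finset.sum_mul_sum]
  refine Finset.sum_congr rfl fun b _ => Finset.sum_eq_single b ?_ (by simp)
  exact fun c _ hc => h.mul_star_eq_zero fun hbc => hc (Subtype.ext hbc).symm

/-- Here cross terms vanish because the final projections are orthogonal. -/
theorem star_mergeEdge_mul (h : G.underlyingGraph.IsCuntzKriegerFamily T Q) (e : E) :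
    star (mergeEdge T e) * mergeEdge T e = ∑ b : G.r e, Q b := by
  rw [mergeEdge, star_sum, Finset.sum_mul_sum]
  refine Finset.sum_congr rfl fun b _ => ?_
  rw [Finset.sum_eq_single b ?_ (by simp)]
  · exact h.star_mul_self _
  · exact fun c _ hc => h.star_mul_eq_zero fun hbc =>
      hc (Subtype.ext (congrArg (fun x => x.1.2) hbc)).symm

theorem star_mergeEdge_mul_eq_zero (h : G.underlyingGraph.IsCuntzKriegerFamily T Q) {e f : E}
    (hef : e ≠ f) : star (mergeEdge T e) * mergeEdge T f = 0 := by
  rw [mergeEdge, mergeEdge, star_sum, Finset.sum_mul_sum]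
  exact Finset.sum_eq_zero fun b _ => Finset.sum_eq_zero fun c _ =>
    h.star_mul_eq_zero fun hbc => hef (congrArg (fun x => x.1.1) hbc)

theorem mergeEdge_mul_sum (h : G.underlyingGraph.IsCuntzKriegerFamily T Q) (e : E) :
    mergeEdge T e * ∑ b : G.r e, Q b = mergeEdge T e := by
  rw [mergeEdge, Finset.sum_mul_sum]
  refine Finset.sum_congr rfl fun b _ => ?_
  rw [Finset.sum_eq_single b ?_ (by simp)]
  · exact h.mul_range _
  · exact fun c _ hc => h.mul_eq_zero fun hbc => hc (Subtype.ext hbc).symm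

theorem source_mul_mergeEdge (h : G.underlyingGraph.IsCuntzKriegerFamily T Q) (e : E) :
    Q (G.s e) * mergeEdge T e = mergeEdge T e := by
  rw [mergeEdge, Finset.mul_sum]
  exact Finset.sum_congr rfl fun b _ => h.source_mul ⟨(e, b), b.2⟩

theorem merge_isCuntzKriegerFamily (hG : G.RowFinite)
    (h : G.underlyingGraph.IsCuntzKriegerFamily T Q) :
    G.IsCuntzKriegerFamily (mergeEdge T) (mergeVertex hG Q) where
  partialIsometry e := by
    rw [IsPartialIsometry, mul_assoc, star_mergeEdge_mul h, mergeEdge_mul_sum h]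
  orthogonal_ranges e f hef := by
    rw [mul_assoc, ← mul_assoc (star _), star_mergeEdge_mul_eq_zero h hef, zero_mul, mul_zero]
  projection A := by
    refine ⟨?_, ?_⟩
    · rw [IsIdempotentElem, mergeVertex_mul hG h]
      congr 2
      exact Set.inter_self _
    · rw [IsSelfAdjoint, mergeVertex, star_sum]
      exact Finset.sum_congr rfl fun a _ => (h.projection a).isSelfAdjoint
  map_empty := by simp [mergeVertex]
  map_inter := mergeVertex_mul hG h
  map_union A A' := by
    classical
    rw [eq_sub_iff_add_eq]
    simp only [mergeVertex]
    -- The union relation becomes inclusion-exclusion for finite sums.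
    rw [← Finset.sum_union_inter (s₁ := (hG.finite_generalizedVertex A).toFinset)
      (s₂ := (hG.finite_generalizedVertex A').toFinset)]
    congr 2 <;> ext <;> simp
  star_mul_self e := by rw [star_mergeEdge_mul h, mergeVertex_range]
  range_le e := by rw [mergeVertex_singleton, ← mul_assoc, source_mul_mergeEdge h]
  sum_ranges a hfin hne := by
    obtain ⟨e, he⟩ := hne
    -- Non-emptiness of `r(e)` ensures that `a` also emits an edge in the underlying graph, so its
    -- summation relation applies there.
    obtain ⟨b, hb⟩ := G.range_nonempty e
    have hfin' : (G.underlyingGraph.s ⁻¹' {a}).Finite := by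
      -- The underlying edges out of `a` lie in the finite union of the sets `{e} × r(e)` with `s(e)
      -- = a`.
      refine Set.Finite.subset (Set.Finite.preimage Subtype.val_injective.injOn
        (hfin.biUnion fun e _ => (Set.finite_singleton e).prod (G.r e).toFinite)) ?_
      rintro ⟨⟨e, b⟩, hb⟩ hx
      simp only [Set.mem_preimage, Set.mem_iUnion]
      exact ⟨e, hx, rfl, hb⟩
    rw [mergeVertex_singleton, h.sum_ranges a hfin' ⟨⟨(e, b), hb⟩, he⟩,
      sum_underlyingGraph_source hfin' hfin]
    exact Finset.sum_congr rfl fun e _ => (mergeEdge_mul_star h e).symm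

end Merge

/-! ### The isomorphism of the universal algebras. -/

/-- Splitting the edges of an ultragraph. -/
def splitTransformation (hG : G.RowFinite) :
    CStarRelations.Transformation.{max u v, max u v, w} G.cuntzKriegerRelations
      G.underlyingGraph.cuntzKriegerRelations where
  toFun _ _ f := Sum.elim (splitEdge (fun e => f (.inl e)) fun A => f (.inr A))
    fun a => f (.inr ⟨{a}, .singleton a⟩)
  holds _ _ _ hf := hf.split hG

/-- Merging the edges of the underlying graph. -/
noncomputable def mergeTransformation (hG : G.RowFinite) [∀ e, Fintype (G.r e)] :
    CStarRelations.Transformation.{max u v, max u v, w}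
      G.underlyingGraph.cuntzKriegerRelations G.cuntzKriegerRelations where
  toFun _ _ f := Sum.elim (mergeEdge fun x => f (.inl x)) (mergeVertex hG fun a => f (.inr a))
  holds _ _ _ hf := merge_isCuntzKriegerFamily hG hf

theorem isPolynomial_splitTransformation (hG : G.RowFinite) :
    (splitTransformation.{u, v, w} hG).IsPolynomial := by
  have hmem := fun x => NonUnitalStarAlgebra.subset_adjoin ℂ
    (Set.range (CStarRelations.productFamily.{max u v, w} G.cuntzKriegerRelations)) ⟨x, rfl⟩
  rintro (x | a)
  · exact ⟨_, mul_mem (hmem (.inl x.1.1)) (hmem (.inr ⟨{x.1.2}, .singleton _⟩)), fun ρ => rfl⟩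
  · exact ⟨_, hmem (.inr ⟨{a}, .singleton a⟩), fun ρ => rfl⟩

theorem isPolynomial_mergeTransformation (hG : G.RowFinite) [∀ e, Fintype (G.r e)] :
    (mergeTransformation.{u, v, w} hG).IsPolynomial := by
  have hmem := fun x => NonUnitalStarAlgebra.subset_adjoin ℂ
    (Set.range (CStarRelations.productFamily.{max u v, w}
      G.underlyingGraph.cuntzKriegerRelations)) ⟨x, rfl⟩
  rintro (e | A)
  · refine ⟨_, sum_mem (t := Finset.univ) fun (b : G.r e) _ => hmem (.inl ⟨(e, b), b.2⟩),
      fun ρ => ?_⟩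
    -- A finite sum in the product is evaluated coordinatewise.
    rw [lp.coeFn_sum, Finset.sum_apply]
    rfl
  · refine ⟨_, sum_mem (t := (hG.finite_generalizedVertex A).toFinset) fun a _ => hmem (.inr a),
      fun ρ => ?_⟩
    rw [lp.coeFn_sum, Finset.sum_apply]
    rfl

end Ultragraph

theorem corollary6p7 {V : Type u} {E : Type v} [Countable V] [Countable E]
    (G : Ultragraph V E) (hG : G.RowFinite) :
    Nonempty (Ultragraph.CStar.{u, v, w} G ≃⋆ₐ[ℂ] DirectedGraph.CStar.{u, max u v, w}
      G.underlyingGraph) := by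
  let := fun e => (hG.finite_range e).fintype
  refine ⟨CStarRelations.universalAlgebraEquiv (Ultragraph.splitTransformation hG)
    (Ultragraph.mergeTransformation hG) (Ultragraph.isPolynomial_splitTransformation hG)
    (Ultragraph.isPolynomial_mergeTransformation hG) ?_ ?_⟩
  · intro B _ f hf
    funext x
    rcases x with e | A
    · exact Ultragraph.IsCuntzKriegerFamily.mergeEdge_splitEdge hf e
    · exact Ultragraph.IsCuntzKriegerFamily.mergeVertex_eq hf hG A
  · intro B _ f hf
    funext x
    rcases x with x | a
    · exact Ultragraph.splitEdge_merge hG hf x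
    · exact Ultragraph.mergeVertex_singleton hG a
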